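/- **Setting.** Let $X$ be a complex Banach space and $B(X)$ the algebra of bounded linear operators on $X$. Let $L^1_s(\mathbb R,B(X))$ be the set of all $\Phi:\mathbb R\to B(X)$ such that $s\mapsto \Phi(s)v$ is (Bochner) measurable for each $v\in X$ and $\|\Phi(s)\|\le f(s)$ a.e. for some $f\in L^1(\mathbb R)$; $\|\Phi\|_1$ is the infimum of $\|f\|_1$ over all such $f$. Let $\mathcal S^1$ be the Stepanov space of (a.e. classes of) locally integrable $x:\mathbb R\to X$ with $\|x\|_{\mathcal S^1}=\sup_{t\in\mathbb R}\int_0^1\|x(s+t)\|\,ds<\infty$. A Banach space $\mathcal F$ of (a.e. classes of) functions $\mathbb R\to X$ is a *homogeneous function space* if 1. $\mathcal F$ is continuously embedded into $\mathcal S^1$; 2. for all $t\in\mathbb R$ and $x\in\mathcal F$, the translate $s\mapsto x(t+s)$ is in $\mathcal F$ and has the same norm as $x$; 3. for all $x\in\mathcal F$ and $C\in B(X)$, the function $t\mapsto C(x(t))$ is in $\mathcal F$ and has norm at most $\|C\|\|x\|$; 4. for all $x\in\mathcal F$ and $\Phi\in L^1_s(\mathbb R,B(X))$, the convolution $(\Phi*x)(t)=\int_{\mathbb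 R}\Phi(s)x(t-s)\,ds$ is in $\mathcal F$ and $\|\Phi*x\|\le\|\Phi\|_1\|x\|$; 5. if $x\in\mathcal F$ and $f*x=0$ for all $f\in L^1(\mathbb R)$, then $x=0$. Let $T:[0,\infty)\to B(X)$ be a $C_0$-semigroup with generator $A$. The operator $\mathscr L_{\mathcal F}=-d/dt+A$ on $\mathcal F$ is defined as follows: $x\in D(\mathscr L_{\mathcal F})$ and $\mathscr L_{\mathcal F}x=y$ if $x,y\in\mathcal F$ and (for a suitable representative of $x$) $$x(t)=T(t-s)x(s)-\int_s^tT(t-\tau)y(\tau)\,d\tau\qquad\text{for all } s\le t \text{ in } \mathbb R.$$ Assume that $T$ is *hyperbolic*, i.e. $\sigma(T(1))\cap\{\lambda\in\mathbb C:|\lambda|=1\}=\emptyset$. Let $$P_{in}=\frac1{2\pi i}\oint_{|\lambda|=1}(\lambda I-T(1))^{-1}\,d\lambda,\qquad P_{out}=I-P_{in},\qquad X_{out}=P_{out}X,$$ where $P_{in}$ is the spectral projection for the part of $\sigma(T(1))$ inside the unit disc. The space $X_{out}$ is invariant under all $T(t)$, $t\ge0$. Put $T_{out}(t)=T(t)|_{X_{out}}$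 for $t\ge0$ and $T_{out}(t)=(T(-t)|_{X_{out}})^{-1}$ for $t<0$. **Theorem 3.1.** Let $\mathcal F$ be any homogeneous function space and let $T$ be hyperbolic. Then $\mathscr L_{\mathcal F}$ is a well-defined (single-valued) operator and it is invertible, i.e. $\ker\mathscr L_{\mathcal F}=\{0\}$ and $\mathscr L_{\mathcal F}D(\mathscr L_{\mathcal F})=\mathcal F$. The operators $T(t)|_{X_{out}}$, $t\ge0$, are invertible in $B(X_{out})$, and the Green function $$G(t)=\begin{cases}-T(t)P_{in},& t\ge0,\\ T_{out}(t)P_{out},& t<0,\end{cases}$$ belongs to $L^1_s(\mathbb R,B(X))$. The inverse $\mathscr L_{\mathcal F}^{-1}$ is a bounded operator on $\mathcal F$ and is given by $$(\mathscr L_{\mathcal F}^{-1}y)(t)=(G*y)(t)=\int_{\mathbb R}G(t-\tau)y(\tau)\,d\tau,\qquad y\in\mathcal F,$$ where the integral converges absolutely for every $t\in\mathbb R$, and the equality is that of elements of $\mathcal F$ (a.e. in $t$). -/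

import Mathlib

open MeasureTheory Set Filter Topology
open scoped NNReal ENNReal

noncomputable section

/-- A `C₀`-semigroup of bounded operators on a complex Banach space. -/
structure C0Semigroup (X : Type*) [NormedAddCommGroup X] [NormedSpace ℂ X] where
  op : ℝ≥0 → X →L[ℂ] X
  op_zero : op 0 = 1
  op_add : ∀ s t, op (s + t) = op s * op t
  continuous_orbit : ∀ v, Continuous fun t => op t v

/-- `f ∈ L¹(ℝ)` and `‖Φ s‖ ≤ f s` for a.e. `s`. -/
def IsMajorant {X : Type*} [NormedAddCommGroup X] [NormedSpace ℂ X]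
    (Φ : ℝ → X →L[ℂ] X) (f : ℝ → ℝ) : Prop :=
  Integrable f volume ∧ ∀ᵐ s, ‖Φ s‖ ≤ f s

/-- The space `L¹_s(ℝ, B(X))`: the functions `Φ : ℝ → B(X)` such that `s ↦ Φ s v` is (Bochner)
measurable for every `v ∈ X`, and `‖Φ s‖ ≤ f s` a.e. for some `f ∈ L¹(ℝ)`. -/
def MemL1s {X : Type*} [NormedAddCommGroup X] [NormedSpace ℂ X]
    (Φ : ℝ → X →L[ℂ] X) : Prop :=
  (∀ v, AEStronglyMeasurable (fun s => Φ s v) volume) ∧ ∃ f, IsMajorant Φ f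

/-- The norm of `L¹_s(ℝ, B(X))`: the infimum of `‖f‖₁` over all majorants `f`. -/
def normL1s {X : Type*} [NormedAddCommGroup X] [NormedSpace ℂ X]
    (Φ : ℝ → X →L[ℂ] X) : ℝ :=
  sInf ((fun f : ℝ → ℝ => ∫ s, ‖f s‖) '' {f | IsMajorant Φ f})

/-- The Stepanov norm `sup_t ∫₀¹ ‖x (s + t)‖ ds`, with values in `[0, ∞]`. -/
def stepanovENorm {X : Type*} [NormedAddCommGroup X] (x : ℝ → X) : ℝ≥0∞ :=
  ⨆ t : ℝ, ∫⁻ s in Icc (0 : ℝ) 1, ‖x (s + t)‖ₑ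

/-- A homogeneous function space: the Banach space `F` is realized, through the injective linear
map `embed`, as a space of (a.e. classes of) functions `ℝ → X`. -/
structure HomogeneousFunctionSpace (X F : Type*)
    [NormedAddCommGroup X] [NormedSpace ℂ X]
    [NormedAddCommGroup F] [NormedSpace ℂ F] [CompleteSpace F] where
  embed : F →ₗ[ℂ] (ℝ →ₘ[volume] X)
  embed_injective : Function.Injective embed
  /-- continuous embedding into the Stepanov space `S¹` -/
  locallyIntegrable : ∀ x, LocallyIntegrable (embed x) volume
  stepanov_le : ∃ c : ℝ≥0, ∀ x, stepanovENorm (embed x) ≤ c * ‖x‖ₑ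
  /-- translations act isometrically -/
  translate : ∀ (t : ℝ) (x : F), ∃ y : F,
    (embed y =ᵐ[volume] fun s => embed x (t + s)) ∧ ‖y‖ = ‖x‖
  /-- bounded operators on `X` act pointwise -/
  apply_op : ∀ (C : X →L[ℂ] X) (x : F), ∃ y : F,
    (embed y =ᵐ[volume] fun t => C (embed x t)) ∧ ‖y‖ ≤ ‖C‖ * ‖x‖
  /-- `L¹_s(ℝ, B(X))` acts by convolution -/
  conv : ∀ (Φ : ℝ → X →L[ℂ] X), MemL1s Φ → ∀ x : F, ∃ y : F,
    (embed y =ᵐ[volume] fun t => ∫ s, Φ s (embed x (t - s))) ∧ ‖y‖ ≤ normL1s Φ * ‖x‖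
  /-- non-degeneracy -/
  nondegenerate : ∀ x : F,
    (∀ f : ℝ → ℂ, Integrable f volume →
      (fun t => ∫ s, f s • embed x (t - s)) =ᵐ[volume] fun _ => (0 : X)) → x = 0

namespace C0Semigroup

variable {X : Type*} [NormedAddCommGroup X] [NormedSpace ℂ X]

/-- The spectrum of `T(1)` does not meet the unit circle. -/
def IsHyperbolic (T : C0Semigroup X) : Prop :=
  spectrum ℂ (T.op 1) ∩ Metric.sphere (0 : ℂ) 1 = ∅

theorem op_commute (T : C0Semigroup X) (s t : ℝ≥0) : Commute (T.op s) (T.op t) := by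
  rw [Commute, SemiconjBy, ← T.op_add, ← T.op_add, add_comm]

/-- The Riesz projection of `T(1)` for the part of the spectrum inside the unit disc,
`(2πi)⁻¹ ∮_{|λ| = 1} (λ - T(1))⁻¹ dλ`. -/
def projIn (T : C0Semigroup X) : X →L[ℂ] X :=
  (2 * Real.pi * Complex.I : ℂ)⁻¹ • ∮ z in C(0, 1), resolvent (T.op 1) z

/-- The complementary projection `I - P_in`. -/
def projOut (T : C0Semigroup X) : X →L[ℂ] X := 1 - T.projIn

/-- The range of `P_out`. -/
def spaceOut (T : C0Semigroup X) : Submodule ℂ X := T.projOut.range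

theorem commute_circleIntegral [CompleteSpace X] {a : X →L[ℂ] X} {f : ℂ → X →L[ℂ] X}
    (h : ∀ z, Commute a (f z)) : Commute a (∮ z in C(0, 1), f z) := by
  simp only [circleIntegral]
  set g : ℝ → X →L[ℂ] X := fun θ => deriv (circleMap 0 1) θ • f (circleMap 0 1 θ) with hg
  by_cases hi : IntervalIntegrable g volume 0 (2 * Real.pi)
  · have h1 := ContinuousLinearMap.intervalIntegral_comp_comm
      (ContinuousLinearMap.mul ℂ (X →L[ℂ] X) a) hi
    have h2 := ContinuousLinearMap.intervalIntegral_comp_comm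
      ((ContinuousLinearMap.mul ℂ (X →L[ℂ] X)).flip a) hi
    simp only [ContinuousLinearMap.mul_apply', ContinuousLinearMap.flip_apply] at h1 h2
    rw [Commute, SemiconjBy, ← h1, ← h2]
    congr 1
    funext θ
    simp only [hg]
    exact ((h _).smul_right _).eq
  · rw [intervalIntegral.integral_undef hi]
    exact Commute.zero_right a

theorem op_commute_projOut [CompleteSpace X] (T : C0Semigroup X) (t : ℝ≥0) :
    Commute (T.op t) T.projOut := by
  refine (Commute.one_right _).sub_right (Commute.smul_right (commute_circleIntegral ?_) _)
  intro z
  have h : Commute (T.op t) (algebraMap ℂ (X →L[ℂ] X) z - T.op 1) :=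
    (Algebra.commute_algebraMap_right z _).sub_right (T.op_commute t 1)
  unfold resolvent
  by_cases hu : IsUnit (algebraMap ℂ (X →L[ℂ] X) z - T.op 1)
  · obtain ⟨w, hw⟩ := hu
    rw [← hw] at h ⊢
    rw [Ring.inverse_unit]
    exact h.units_inv_right
  · rw [Ring.inverse_non_unit _ hu]
    exact Commute.zero_right _

theorem op_mem_spaceOut [CompleteSpace X] (T : C0Semigroup X) (t : ℝ≥0) :
    ∀ v ∈ T.spaceOut, T.op t v ∈ T.spaceOut := by
  rintro _ ⟨w, rfl⟩
  exact ⟨T.op t w, (DFunLike.congr_fun (T.op_commute_projOut t).eq w).symm⟩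

/-- The restriction of `T(t)`, `t ≥ 0`, to the range of `P_out`. -/
def restrictOut [CompleteSpace X] (T : C0Semigroup X) (t : ℝ≥0) :
    T.spaceOut →L[ℂ] T.spaceOut :=
  (T.op t).restrict (T.op_mem_spaceOut t)

/-- `T_out(t)`: the restriction of `T(t)` for `t ≥ 0`, the inverse of the restriction of `T(-t)`
for `t < 0`. -/
def groupOut [CompleteSpace X] (T : C0Semigroup X) (t : ℝ) : T.spaceOut →L[ℂ] T.spaceOut :=
  if 0 ≤ t then T.restrictOut t.toNNReal else (T.restrictOut (-t).toNNReal).inverse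

/-- The Green function: `-T(t) P_in` for `t ≥ 0`, and `T_out(t) P_out` for `t < 0`. -/
def green [CompleteSpace X] (T : C0Semigroup X) (t : ℝ) : X →L[ℂ] X :=
  if 0 ≤ t then -(T.op t.toNNReal * T.projIn)
  else T.spaceOut.subtypeL ∘L T.groupOut t ∘L T.projOut.rangeRestrict

theorem continuous_uncurry [CompleteSpace X] (T : C0Semigroup X) :
    Continuous fun p : ℝ≥0 × X => T.op p.1 p.2 := by
  rw [continuous_iff_continuousAt]
  rintro ⟨a, v⟩
  obtain ⟨M, hM⟩ : ∃ M, ∀ i : Icc (0 : ℝ≥0) (a + 1), ‖T.op i‖ ≤ M := by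
    refine banach_steinhaus fun w => ?_
    obtain ⟨c, hc⟩ := (isCompact_Icc (a := (0 : ℝ≥0)) (b := a + 1)).exists_bound_of_continuousOn
      (T.continuous_orbit w).continuousOn
    exact ⟨c, fun i => hc i i.2⟩
  have h0 : Tendsto (fun p : ℝ≥0 × X => M * ‖p.2 - v‖ + ‖T.op p.1 v - T.op a v‖)
      (𝓝 (a, v)) (𝓝 0) := by
    have hc : Continuous fun p : ℝ≥0 × X => M * ‖p.2 - v‖ + ‖T.op p.1 v - T.op a v‖ := by
      have := (T.continuous_orbit v).comp (continuous_fst (X := ℝ≥0) (Y := X))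
      simp only [Function.comp_def] at this
      fun_prop
    simpa using hc.tendsto (a, v)
  rw [ContinuousAt, tendsto_iff_norm_sub_tendsto_zero]
  refine squeeze_zero' (Eventually.of_forall fun _ => norm_nonneg _) ?_ h0
  have hlt : ∀ᶠ p : ℝ≥0 × X in 𝓝 (a, v), p.1 < a + 1 :=
    (continuous_fst.tendsto (a, v)).eventually_lt_const (by simp)
  filter_upwards [hlt] with p hp
  have hb := hM ⟨p.1, zero_le, hp.le⟩
  calc ‖T.op p.1 p.2 - T.op a v‖
      = ‖T.op p.1 (p.2 - v) + (T.op p.1 v - T.op a v)‖ := by rw [map_sub]; congr 1; abel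
    _ ≤ ‖T.op p.1 (p.2 - v)‖ + ‖T.op p.1 v - T.op a v‖ := norm_add_le _ _
    _ ≤ M * ‖p.2 - v‖ + ‖T.op p.1 v - T.op a v‖ := by
      gcongr
      exact (T.op p.1).le_of_opNorm_le hb _

theorem intervalIntegrable [CompleteSpace X] (T : C0Semigroup X) {y : ℝ → X}
    (hy : LocallyIntegrable y volume) {s t : ℝ} (hst : s ≤ t) :
    IntervalIntegrable (fun τ => T.op (t - τ).toNNReal (y τ)) volume s t := by
  rw [intervalIntegrable_iff_integrableOn_Icc_of_le hst]
  have hyi : IntegrableOn y (Icc s t) volume := hy.integrableOn_isCompact isCompact_Icc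
  obtain ⟨M, hM⟩ : ∃ M, ∀ i : Icc (0 : ℝ≥0) (t - s).toNNReal, ‖T.op i‖ ≤ M := by
    refine banach_steinhaus fun w => ?_
    obtain ⟨c, hc⟩ := (isCompact_Icc (a := (0 : ℝ≥0))
      (b := (t - s).toNNReal)).exists_bound_of_continuousOn (T.continuous_orbit w).continuousOn
    exact ⟨c, fun i => hc i i.2⟩
  refine Integrable.mono' (g := fun τ => M * ‖y τ‖) (hyi.norm.const_mul M) ?_ ?_
  · have hc : Continuous fun τ : ℝ => (t - τ).toNNReal := by fun_prop
    exact T.continuous_uncurry.comp_aestronglyMeasurable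
      (hc.aestronglyMeasurable.prodMk hyi.aestronglyMeasurable)
  · filter_upwards [ae_restrict_mem measurableSet_Icc] with τ hτ
    exact (T.op _).le_of_opNorm_le
      (hM ⟨_, zero_le, Real.toNNReal_le_toNNReal (by linarith [hτ.1])⟩) _

end C0Semigroup

/-- The graph of `-d/dt + A`: pairs `(x, y)` such that (the representative `u` of) `x` satisfies
`x(t) = T(t - s) x(s) - ∫_s^t T(t - τ) y(τ) dτ` for all `s ≤ t`. -/
def parabolicGraph {X F : Type*} [NormedAddCommGroup X] [NormedSpace ℂ X] [CompleteSpace X]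
    [NormedAddCommGroup F] [NormedSpace ℂ F] [CompleteSpace F]
    (T : C0Semigroup X) (H : HomogeneousFunctionSpace X F) : Submodule ℂ (F × F) where
  carrier := {p | ∃ u : ℝ → X, u =ᵐ[volume] H.embed p.1 ∧ ∀ s t : ℝ, s ≤ t →
    u t = T.op (t - s).toNNReal (u s) - ∫ τ in s..t, T.op (t - τ).toNNReal (H.embed p.2 τ)}
  zero_mem' := by
    have h0 : (H.embed (0 : F) : ℝ → X) =ᵐ[volume] 0 := by
      rw [map_zero]; exact AEEqFun.coeFn_zero
    refine ⟨0, h0.symm, fun s t _ => ?_⟩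
    rw [intervalIntegral.integral_congr_ae (g := fun _ => (0 : X))]
    · simp
    · filter_upwards [h0] with τ hτ _
      simp only [Prod.snd_zero]
      rw [hτ, Pi.zero_apply, map_zero]
  add_mem' := by
    rintro ⟨x, y⟩ ⟨x', y'⟩ ⟨u, hu, hut⟩ ⟨u', hu', hut'⟩
    have ha : ∀ z z' : F, (H.embed (z + z') : ℝ → X) =ᵐ[volume] H.embed z + H.embed z' := by
      intro z z'; rw [map_add]; exact AEEqFun.coeFn_add _ _
    refine ⟨u + u', (hu.add hu').trans (ha x x').symm, fun s t hst => ?_⟩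
    have hint : ∫ τ in s..t, T.op (t - τ).toNNReal (H.embed (y + y') τ) =
        (∫ τ in s..t, T.op (t - τ).toNNReal (H.embed y τ)) +
          ∫ τ in s..t, T.op (t - τ).toNNReal (H.embed y' τ) := by
      rw [← intervalIntegral.integral_add (T.intervalIntegrable (H.locallyIntegrable y) hst)
        (T.intervalIntegrable (H.locallyIntegrable y') hst)]
      refine intervalIntegral.integral_congr_ae ?_
      filter_upwards [ha y y'] with τ hτ _
      rw [hτ, Pi.add_apply, map_add]
    simp only [Prod.mk_add_mk, Pi.add_apply]
    rw [hint, hut s t hst, hut' s t hst, map_add]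
    abel
  smul_mem' := by
    rintro c ⟨x, y⟩ ⟨u, hu, hut⟩
    have ha : ∀ z : F, (H.embed (c • z) : ℝ → X) =ᵐ[volume] c • (H.embed z : ℝ → X) := by
      intro z; rw [map_smul]; exact AEEqFun.coeFn_smul _ _
    refine ⟨c • u, (hu.const_smul c).trans (ha x).symm, fun s t hst => ?_⟩
    have hint : ∫ τ in s..t, T.op (t - τ).toNNReal (H.embed (c • y) τ) =
        c • ∫ τ in s..t, T.op (t - τ).toNNReal (H.embed y τ) := by
      rw [← intervalIntegral.integral_smul]
      refine intervalIntegral.integral_congr_ae ?_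
      filter_upwards [ha y] with τ hτ _
      rw [hτ, Pi.smul_apply, map_smul]
    simp only [Prod.smul_mk, Pi.smul_apply]
    rw [hint, hut s t hst, smul_sub, map_smul]

/-- The operator `L_F = -d/dt + A` with its domain: the partially defined linear map whose graph
is `parabolicGraph T H`. -/
def parabolicOperator {X F : Type*} [NormedAddCommGroup X] [NormedSpace ℂ X] [CompleteSpace X]
    [NormedAddCommGroup F] [NormedSpace ℂ F] [CompleteSpace F]
    (T : C0Semigroup X) (H : HomogeneousFunctionSpace X F) : F →ₗ.[ℂ] F :=
  (parabolicGraph T H).toLinearPMap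

end

/-! Write a = T(1) and c_n = (2πi)⁻¹ ∮ zⁿ (z - a)⁻¹ dz over the unit circle, so that c_0 = P_in.
Since z (z - a)⁻¹ = 1 + a (z - a)⁻¹, these operators solve c_{n+1} = a c_n + δ_{n,-1}, and by the
Riemann-Lebesgue lemma they tend to 0 at both ends. These facts, together with commutation, already
force c_0 to be a projection and ‖c_n‖ to be summable (`IsGreenSequence`); no functional calculus is
needed.

The Green function is G(t) = -T(t - ⌊t⌋) c_⌊t⌋ (`green_eq_laurentGreen`). On [n, n + 1) it is
bounded by a constant times ‖c_n‖, so it lies in L¹_s and integrates absolutely against Stepanov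
functions. Its jump relation `op_mul_green`, integrated against y, says that G * y solves the
defining equation (`green_conv_eq`).

Conversely, a solution for y = 0 is a bounded orbit on all of ℝ: following it from -∞ kills its P_in
part, following it to +∞ its P_out part (`eq_zero_of_orbit`). Single-valuedness comes from Lebesgue
differentiation and strong continuity (`ae_eq_zero_of_solution`). -/

/-! ### Two-sided sequences solving c_{n+1} = a c_n + δ_{n,-1} -/

theorem summable_of_add_le_mul {u : ℕ → ℝ} (hu : ∀ n, 0 ≤ u n) {r : ℝ} (hr : r < 1) (N : ℕ)
    (h : ∀ n, u (n + N) ≤ r * u n) : Summable u := by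
  have hr' : 0 < 1 - r := by linarith
  -- With S_n the partial sums, S_n ≤ S_{N+n} ≤ S_N + r S_n.
  refine summable_of_sum_range_le (c := (∑ i ∈ Finset.range N, u i) / (1 - r)) hu fun n => ?_
  rw [le_div_iff₀ hr']
  have h1 : ∑ i ∈ Finset.range n, u i ≤ ∑ i ∈ Finset.range (N + n), u i :=
    Finset.sum_le_sum_of_subset_of_nonneg (by simp) fun i _ _ => hu i
  have h2 : ∑ i ∈ Finset.range n, u (N + i) ≤ r * ∑ i ∈ Finset.range n, u i := by
    rw [Finset.mul_sum]
    exact Finset.sum_le_sum fun i _ => by rw [add_comm]; exact h i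
  rw [Finset.sum_range_add] at h1
  linarith

/-- A bi-infinite sequence in a normed ring `A`, tending to zero and commuting with `a`, such that
`c (n + 1) - a * c n` is `1` for `n = -1` and `0` otherwise: the coefficients of the Laurent
series of `(1 - a / z)⁻¹` on the unit circle. -/
structure IsGreenSequence {A : Type*} [NormedRing A] (a : A) (c : ℤ → A) : Prop where
  succ : ∀ n, c (n + 1) = a * c n + if n = -1 then 1 else 0
  commute : ∀ n, Commute a (c n)
  tendsto_nat : Tendsto (fun n : ℕ => c n) atTop (𝓝 0)
  tendsto_negSucc : Tendsto (fun n : ℕ => c (Int.negSucc n)) atTop (𝓝 0)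

namespace IsGreenSequence

variable {A : Type*} [NormedRing A] {a : A} {c : ℤ → A}

theorem nat_eq (h : IsGreenSequence a c) (n : ℕ) : c n = a ^ n * c 0 := by
  induction n with
  | zero => simp
  | succ k ih =>
    have := h.succ k
    rw [if_neg (by lia), add_zero, ih, ← mul_assoc, ← pow_succ'] at this
    exact_mod_cast this

theorem negSucc_eq (h : IsGreenSequence a c) (n k : ℕ) :
    c (Int.negSucc n) = a ^ k * c (Int.negSucc (n + k)) := by
  induction k with
  | zero => simp
  | succ k ih =>
    have := h.succ (Int.negSucc (n + (k + 1)))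
    rw [if_neg (by lia), add_zero,
      show Int.negSucc (n + (k + 1)) + 1 = Int.negSucc (n + k) by lia] at this
    rw [ih, this, ← mul_assoc, pow_succ]

/-- Climbing from -n-1 to 0 crosses the source at -1 exactly once. -/
theorem pow_mul_negSucc (h : IsGreenSequence a c) (n : ℕ) :
    a ^ (n + 1) * c (Int.negSucc n) = c 0 - 1 := by
  have h0 := h.succ (-1)
  rw [if_pos rfl, show (-1 : ℤ) + 1 = 0 by lia, show (-1 : ℤ) = Int.negSucc 0 from rfl,
    h.negSucc_eq 0 n, zero_add, ← mul_assoc, ← pow_succ'] at h0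
  rw [h0, add_sub_cancel_right]

/-- Moving a^k from one factor to the other rewrites the product as c_k c_{-(n+k)-1}, for every k,
and both factors tend to 0. -/
theorem zero_mul_negSucc (h : IsGreenSequence a c) (n : ℕ) : c 0 * c (Int.negSucc n) = 0 := by
  have h1 : ∀ k : ℕ, c k * c (Int.negSucc (n + k)) = c 0 * c (Int.negSucc n) := fun k => by
    rw [h.nat_eq, h.negSucc_eq n k, ← mul_assoc, ((h.commute 0).pow_left k).eq]
  have h2 : Tendsto (fun k : ℕ => c k * c (Int.negSucc (n + k))) atTop (𝓝 (0 * 0)) := by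
    refine h.tendsto_nat.mul ?_
    have := h.tendsto_negSucc.comp (tendsto_add_atTop_nat n)
    simpa [Function.comp_def, add_comm] using this
  simp only [h1, zero_mul] at h2
  exact tendsto_nhds_unique tendsto_const_nhds h2

theorem negSucc_mul_zero (h : IsGreenSequence a c) (n : ℕ) : c (Int.negSucc n) * c 0 = 0 := by
  have h1 : ∀ k : ℕ, c (Int.negSucc (n + k)) * c k = c (Int.negSucc n) * c 0 := fun k => by
    rw [h.nat_eq, h.negSucc_eq n k, ← mul_assoc, ((h.commute _).pow_left k).eq]
  have h2 : Tendsto (fun k : ℕ => c (Int.negSucc (n + k)) * c k) atTop (𝓝 (0 * 0)) := by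
    refine Tendsto.mul ?_ h.tendsto_nat
    have := h.tendsto_negSucc.comp (tendsto_add_atTop_nat n)
    simpa [Function.comp_def, add_comm] using this
  simp only [h1, zero_mul] at h2
  exact tendsto_nhds_unique tendsto_const_nhds h2

theorem zero_mul_self (h : IsGreenSequence a c) : c 0 * c 0 = c 0 := by
  have h0 : c 0 * (c 0 - 1) = 0 := by
    rw [← h.pow_mul_negSucc 0, ← mul_assoc, ← ((h.commute 0).pow_left _).eq, mul_assoc,
      h.zero_mul_negSucc, mul_zero]
  rwa [mul_sub, mul_one, sub_eq_zero] at h0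

/-- Idempotence of c_0 gives c_{n+N} = c_N c_n; decay provides N with ‖c_N‖ < 1. -/
theorem summable_norm_nat (h : IsGreenSequence a c) : Summable fun n : ℕ => ‖c n‖ := by
  obtain ⟨N, hN⟩ := (h.tendsto_nat.norm.eventually_lt_const (u := 1) (by simp)).exists
  refine summable_of_add_le_mul (fun _ => norm_nonneg _) hN N fun n => ?_
  have : c ((n + N : ℕ) : ℤ) = c N * c n := by
    rw [h.nat_eq, h.nat_eq n, h.nat_eq N, mul_assoc, ← mul_assoc (c 0),
      ← ((h.commute 0).pow_left n).eq, mul_assoc (a ^ n), h.zero_mul_self, ← mul_assoc, ← pow_add,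
      add_comm]
  rw [this]
  exact norm_mul_le _ _

theorem summable_norm_negSucc (h : IsGreenSequence a c) :
    Summable fun n : ℕ => ‖c (Int.negSucc n)‖ := by
  obtain ⟨N, hN⟩ := (h.tendsto_negSucc.norm.eventually_lt_const (u := 1) (by simp)).exists
  refine summable_of_add_le_mul (fun _ => norm_nonneg _) hN (N + 1) fun n => ?_
  -- The shift is N + 1 because a^{N+1} c_{-N-1} = c_0 - 1, and c_0 annihilates the negative
  -- coefficients.
  have : c (Int.negSucc (n + (N + 1))) = -(c (Int.negSucc N) * c (Int.negSucc n)) := by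
    rw [h.negSucc_eq n (N + 1), ← mul_assoc, ← ((h.commute _).pow_left _).eq, h.pow_mul_negSucc,
      sub_mul, h.zero_mul_negSucc]
    simp
  rw [this, norm_neg]
  exact norm_mul_le _ _

theorem summable_norm (h : IsGreenSequence a c) : Summable fun n : ℤ => ‖c n‖ := by
  refine Summable.of_nat_of_neg_add_one h.summable_norm_nat ?_
  have := h.summable_norm_negSucc
  simp only [Int.negSucc_eq] at this
  simpa using this

end IsGreenSequence

/-! ### Laurent coefficients of the resolvent on the unit circle -/

noncomputable section

/-- The Laurent coefficients of `z (z - a)⁻¹` on the unit circle. -/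
def laurentCoeff {A : Type*} [NormedRing A] [NormedAlgebra ℂ A] (a : A) (n : ℤ) : A :=
  (2 * Real.pi * Complex.I : ℂ)⁻¹ • ∮ z in C(0, 1), z ^ n • resolvent a z

theorem circleIntegral_zpow (n : ℤ) :
    (∮ z in C(0, 1), z ^ n) = if n = -1 then (2 * Real.pi * Complex.I : ℂ) else 0 := by
  split_ifs with h
  · have := circleIntegral.integral_sub_center_inv (0 : ℂ) (R := 1) one_ne_zero
    simpa [h] using this
  · simpa using circleIntegral.integral_sub_zpow_of_ne h 0 0 1

section Laurent

variable {A : Type*} [NormedRing A] [NormedAlgebra ℂ A] {a : A}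

theorem mem_resolventSet_of_disjoint (ha : spectrum ℂ a ∩ Metric.sphere (0 : ℂ) 1 = ∅) {z : ℂ}
    (hz : z ∈ Metric.sphere (0 : ℂ) 1) : z ∈ resolventSet ℂ a := by
  by_contra h
  exact (Set.ext_iff.1 ha z).1 ⟨h, hz⟩

/-- Parametrized by the angle, these are Fourier coefficients of one fixed function, so the
Riemann-Lebesgue lemma applies. -/
theorem tendsto_laurentCoeff {ι : Type*} {l : Filter ι} {f : ι → ℤ}
    (hf : Tendsto (fun i => (f i : ℝ)) l (cocompact ℝ)) :
    Tendsto (fun i => laurentCoeff a (f i)) l (𝓝 0) := by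
  set g : ℝ → A := (Ioc 0 (2 * Real.pi)).indicator
    fun θ => (circleMap 0 1 θ * Complex.I) • resolvent a (circleMap 0 1 θ) with hg
  have h1 := Real.tendsto_integral_exp_smul_cocompact g
  -- The character exp(-2πiθw) at w = -n/(2π) is exp(inθ).
  have h2 : Tendsto (fun i => (f i : ℝ) * -(2 * Real.pi)⁻¹) l (cocompact ℝ) :=
    (Homeomorph.mulRight₀ (-(2 * Real.pi)⁻¹) (by simp [Real.pi_ne_zero])).isClosedEmbedding
      |>.tendsto_cocompact.comp hf
  have h3 := (h1.comp h2).const_smul (2 * Real.pi * Complex.I : ℂ)⁻¹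
  rw [smul_zero] at h3
  refine h3.congr fun i => ?_
  rw [laurentCoeff, circleIntegral, intervalIntegral.integral_of_le Real.two_pi_pos.le,
    ← integral_indicator measurableSet_Ioc]
  simp only [Function.comp_apply]
  congr 2
  funext θ
  simp only [hg, indicator]
  split_ifs
  · rw [Circle.smul_def, Real.fourierChar_apply, deriv_circleMap, smul_smul, smul_smul, mul_comm]
    congr 2
    simp only [circleMap, zero_add, Complex.ofReal_one, one_mul]
    rw [← Complex.exp_int_mul]
    congr 1
    push_cast
    have : (Real.pi : ℂ) ≠ 0 := by exact_mod_cast Real.pi_ne_zero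
    field_simp
  · simp

variable [CompleteSpace A]

theorem circleIntegrable_zpow_smul_resolvent
    (ha : spectrum ℂ a ∩ Metric.sphere (0 : ℂ) 1 = ∅) (n : ℤ) :
    CircleIntegrable (fun z => z ^ n • resolvent a z) 0 1 := by
  refine ContinuousOn.circleIntegrable zero_le_one fun z hz => ContinuousAt.continuousWithinAt ?_
  have hz0 : z ≠ 0 := by rintro rfl; simp at hz
  exact (continuousAt_zpow₀ z n (Or.inl hz0)).smul
    (spectrum.hasDerivAt_resolvent_const_left (mem_resolventSet_of_disjoint ha hz)).continuousAt

/-- Integrate zⁿ · z (z - a)⁻¹ = zⁿ + a zⁿ (z - a)⁻¹; the source is ∮ zⁿ dz, nonzero only for n =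
-1. -/
theorem laurentCoeff_succ (ha : spectrum ℂ a ∩ Metric.sphere (0 : ℂ) 1 = ∅) (n : ℤ) :
    laurentCoeff a (n + 1) = a * laurentCoeff a n + if n = -1 then 1 else 0 := by
  have h1 : (∮ z in C(0, 1), z ^ (n + 1) • resolvent a z) =
      ∮ z in C(0, 1), (z ^ n • (1 : A) + a * (z ^ n • resolvent a z)) := by
    refine circleIntegral.integral_congr zero_le_one fun z hz => ?_
    have hz0 : z ≠ 0 := by rintro rfl; simp at hz
    have hu : (algebraMap ℂ A z - a) * resolvent a z = 1 :=
      Ring.mul_inverse_cancel _ (mem_resolventSet_of_disjoint ha hz)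
    rw [sub_mul, Algebra.algebraMap_eq_smul_one, smul_mul_assoc, one_mul, sub_eq_iff_eq_add] at hu
    rw [zpow_add_one₀ hz0, mul_smul, hu, smul_add, mul_smul_comm]
  have hi1 : CircleIntegrable (fun z : ℂ => z ^ n • (1 : A)) 0 1 := by
    refine ContinuousOn.circleIntegrable zero_le_one fun z hz => ContinuousAt.continuousWithinAt ?_
    have hz0 : z ≠ 0 := by rintro rfl; simp at hz
    exact (continuousAt_zpow₀ z n (Or.inl hz0)).smul continuousAt_const
  have hi2 := circleIntegrable_zpow_smul_resolvent ha n
  have hi3 : CircleIntegrable (fun z : ℂ => a * (z ^ n • resolvent a z)) 0 1 := by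
    have := (ContinuousLinearMap.mul ℂ A a).integrable_comp hi2.1
    have h' := (ContinuousLinearMap.mul ℂ A a).integrable_comp hi2.2
    exact ⟨this, h'⟩
  have h2 : (∮ z in C(0, 1), a * (z ^ n • resolvent a z)) =
      a * ∮ z in C(0, 1), z ^ n • resolvent a z := by
    have := ContinuousLinearMap.intervalIntegral_comp_comm (ContinuousLinearMap.mul ℂ A a)
      hi2.out
    simp only [circleIntegral]
    simp only [ContinuousLinearMap.mul_apply'] at this
    rw [← this]
    congr 1
    funext θ
    simp only [mul_smul_comm]
  rw [laurentCoeff, laurentCoeff, h1, circleIntegral.integral_add hi1 hi3, h2,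
    circleIntegral.integral_smul_const, circleIntegral_zpow, smul_add, add_comm, mul_smul_comm]
  congr 1
  split_ifs with h
  · rw [smul_smul, inv_mul_cancel₀ Complex.two_pi_I_ne_zero, one_smul]
  · simp

end Laurent

end

/-! ### The Green function of a hyperbolic semigroup -/

namespace C0Semigroup

variable {X : Type*} [NormedAddCommGroup X] [NormedSpace ℂ X]

theorem op_natCast (T : C0Semigroup X) (n : ℕ) : T.op n = T.op 1 ^ n := by
  induction n with
  | zero => simpa using T.op_zero
  | succ k ih => rw [Nat.cast_succ, T.op_add, ih, pow_succ]

theorem op_toNNReal_add (T : C0Semigroup X) {s t : ℝ} (hs : 0 ≤ s) (ht : 0 ≤ t) :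
    T.op (s + t).toNNReal = T.op s.toNNReal * T.op t.toNNReal := by
  rw [Real.toNNReal_add hs ht, T.op_add]

theorem laurentCoeff_zero (T : C0Semigroup X) : laurentCoeff (T.op 1) 0 = T.projIn := by
  simp [laurentCoeff, projIn]

variable [CompleteSpace X]

theorem op_commute_laurentCoeff (T : C0Semigroup X) (t : ℝ≥0) (n : ℤ) :
    Commute (T.op t) (laurentCoeff (T.op 1) n) := by
  refine Commute.smul_right (commute_circleIntegral fun z => Commute.smul_right ?_ _) _
  have h : Commute (T.op t) (algebraMap ℂ (X →L[ℂ] X) z - T.op 1) :=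
    (Algebra.commute_algebraMap_right z _).sub_right (T.op_commute t 1)
  unfold resolvent
  by_cases hu : IsUnit (algebraMap ℂ (X →L[ℂ] X) z - T.op 1)
  · obtain ⟨w, hw⟩ := hu
    rw [← hw] at h ⊢
    rw [Ring.inverse_unit]
    exact h.units_inv_right
  · rw [Ring.inverse_non_unit _ hu]
    exact Commute.zero_right _

theorem isGreenSequence (T : C0Semigroup X) (hT : T.IsHyperbolic) :
    IsGreenSequence (T.op 1) (laurentCoeff (T.op 1)) where
  succ := laurentCoeff_succ hT
  commute := T.op_commute_laurentCoeff 1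
  tendsto_nat := by
    refine tendsto_laurentCoeff (f := fun n : ℕ => (n : ℤ)) ?_
    simpa using tendsto_natCast_atTop_atTop.mono_right (atTop_le_cocompact (α := ℝ))
  tendsto_negSucc := by
    refine tendsto_laurentCoeff (f := fun n : ℕ => Int.negSucc n) ?_
    refine Tendsto.mono_right ?_ (atBot_le_cocompact (α := ℝ))
    simp only [Int.cast_negSucc]
    exact tendsto_neg_atTop_atBot.comp
      ((tendsto_natCast_atTop_atTop (R := ℝ)).comp (tendsto_add_atTop_nat 1))

noncomputable section

/-- The Green function, expressed through the Laurent coefficients of the resolvent of `T(1)`. -/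
def laurentGreen (T : C0Semigroup X) (t : ℝ) : X →L[ℂ] X :=
  -(T.op (Int.fract t).toNNReal * laurentCoeff (T.op 1) ⌊t⌋)

end

theorem op_commute_laurentGreen (T : C0Semigroup X) (r : ℝ≥0) (t : ℝ) :
    Commute (T.op r) (T.laurentGreen t) :=
  ((T.op_commute r _).mul_right (T.op_commute_laurentCoeff r _)).neg_right

theorem laurentGreen_of_nonneg (T : C0Semigroup X) (hT : T.IsHyperbolic) {t : ℝ} (ht : 0 ≤ t) :
    T.laurentGreen t = -(T.op t.toNNReal * T.projIn) := by
  obtain ⟨n, hn⟩ := Int.eq_ofNat_of_zero_le (Int.floor_nonneg.2 ht)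
  have h1 : T.op t.toNNReal = T.op (Int.fract t).toNNReal * T.op 1 ^ n := by
    rw [← T.op_natCast]
    conv_lhs => rw [← Int.fract_add_floor t, hn]
    rw [T.op_toNNReal_add (Int.fract_nonneg t) (by simp)]
    simp
  rw [laurentGreen, hn, (T.isGreenSequence hT).nat_eq, h1, T.laurentCoeff_zero, mul_assoc]

theorem exists_floor_eq_negSucc {t : ℝ} (ht : t < 0) : ∃ n : ℕ, ⌊t⌋ = Int.negSucc n := by
  have := Int.floor_lt.2 (show t < ((0 : ℤ) : ℝ) by simpa using ht)
  exact ⟨(-⌊t⌋ - 1).toNat, by lia⟩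

/-- The times -t and t - ⌊t⌋ add up to the integer -⌊t⌋ = n + 1, which reduces the claim to
`pow_mul_negSucc`. With the commuted version below, this makes G(t) the inverse of T(-t) on X_out.
-/
theorem op_mul_laurentGreen (T : C0Semigroup X) (hT : T.IsHyperbolic) {t : ℝ} (ht : t < 0) :
    T.op (-t).toNNReal * T.laurentGreen t = T.projOut := by
  obtain ⟨n, hn⟩ := exists_floor_eq_negSucc ht
  have h1 : T.op (-t).toNNReal * T.op (Int.fract t).toNNReal = T.op 1 ^ (n + 1) := by
    rw [← T.op_toNNReal_add (by linarith) (Int.fract_nonneg t), ← T.op_natCast]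
    congr 1
    rw [Int.fract, hn, Int.cast_negSucc]
    ring_nf
    rw [add_comm]
    exact_mod_cast Real.toNNReal_natCast (n + 1)
  rw [laurentGreen, mul_neg, ← mul_assoc, h1, hn, (T.isGreenSequence hT).pow_mul_negSucc,
    T.laurentCoeff_zero, neg_sub, projOut]

theorem laurentGreen_mul_op (T : C0Semigroup X) (hT : T.IsHyperbolic) {t : ℝ} (ht : t < 0) :
    T.laurentGreen t * T.op (-t).toNNReal = T.projOut := by
  rw [← (T.op_commute_laurentGreen _ t).eq, T.op_mul_laurentGreen hT ht]

theorem laurentGreen_mul_projOut (T : C0Semigroup X) (hT : T.IsHyperbolic) {t : ℝ} (ht : t < 0) :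
    T.laurentGreen t * T.projOut = T.laurentGreen t := by
  obtain ⟨n, hn⟩ := exists_floor_eq_negSucc ht
  rw [projOut, mul_sub, mul_one, laurentGreen, hn, neg_mul, mul_assoc, ← T.laurentCoeff_zero,
    (T.isGreenSequence hT).negSucc_mul_zero]
  simp

theorem projOut_mul_laurentGreen (T : C0Semigroup X) (hT : T.IsHyperbolic) {t : ℝ} (ht : t < 0) :
    T.projOut * T.laurentGreen t = T.laurentGreen t := by
  obtain ⟨n, hn⟩ := exists_floor_eq_negSucc ht
  rw [projOut, sub_mul, one_mul, laurentGreen, hn, mul_neg, ← mul_assoc, ← T.laurentCoeff_zero,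
    ← (T.op_commute_laurentCoeff _ 0).eq, mul_assoc, (T.isGreenSequence hT).zero_mul_negSucc]
  simp

theorem projOut_mul_self (T : C0Semigroup X) (hT : T.IsHyperbolic) :
    T.projOut * T.projOut = T.projOut := by
  rw [projOut, ← T.laurentCoeff_zero, mul_sub, mul_one, sub_mul, one_mul,
    (T.isGreenSequence hT).zero_mul_self, sub_self, sub_zero]

theorem projOut_apply (T : C0Semigroup X) (hT : T.IsHyperbolic) (v : T.spaceOut) :
    T.projOut v = v := by
  obtain ⟨_, w, rfl⟩ := v
  exact DFunLike.congr_fun (T.projOut_mul_self hT) w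

theorem laurentGreen_mem_spaceOut (T : C0Semigroup X) (hT : T.IsHyperbolic) {t : ℝ} (ht : t < 0)
    (v : X) : T.laurentGreen t v ∈ T.spaceOut :=
  ⟨T.laurentGreen t v, DFunLike.congr_fun (T.projOut_mul_laurentGreen hT ht) v⟩

theorem restrictOut_comp_restrict (T : C0Semigroup X) (hT : T.IsHyperbolic) {t : ℝ} (ht : t < 0) :
    T.restrictOut (-t).toNNReal ∘L
      (T.laurentGreen t).restrict (fun v _ => T.laurentGreen_mem_spaceOut hT ht v) =
        ContinuousLinearMap.id ℂ T.spaceOut := by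
  ext v
  exact (DFunLike.congr_fun (T.op_mul_laurentGreen hT ht) (v : X)).trans (T.projOut_apply hT v)

theorem restrict_comp_restrictOut (T : C0Semigroup X) (hT : T.IsHyperbolic) {t : ℝ} (ht : t < 0) :
    (T.laurentGreen t).restrict (fun v _ => T.laurentGreen_mem_spaceOut hT ht v) ∘L
      T.restrictOut (-t).toNNReal = ContinuousLinearMap.id ℂ T.spaceOut := by
  ext v
  exact (DFunLike.congr_fun (T.laurentGreen_mul_op hT ht) (v : X)).trans (T.projOut_apply hT v)

theorem restrictOut_isInvertible (T : C0Semigroup X) (hT : T.IsHyperbolic) (t : ℝ≥0) :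
    (T.restrictOut t).IsInvertible := by
  rcases eq_or_ne t 0 with rfl | ht
  · have : T.restrictOut 0 = ContinuousLinearMap.id ℂ T.spaceOut := by
      ext v
      exact DFunLike.congr_fun T.op_zero (v : X)
    exact ⟨ContinuousLinearEquiv.refl ℂ _, this.symm⟩
  · have ht' : -(t : ℝ) < 0 := by simpa using pos_iff_ne_zero.2 ht
    have h1 := T.restrictOut_comp_restrict hT ht'
    have h2 := T.restrict_comp_restrictOut hT ht'
    rw [neg_neg, Real.toNNReal_coe] at h1 h2
    exact ContinuousLinearMap.IsInvertible.of_inverse h1 h2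

theorem green_eq_laurentGreen (T : C0Semigroup X) (hT : T.IsHyperbolic) (t : ℝ) :
    T.green t = T.laurentGreen t := by
  rw [green]
  split_ifs with ht
  · rw [T.laurentGreen_of_nonneg hT ht]
  · rw [groupOut, if_neg ht, ContinuousLinearMap.inverse_eq
      (T.restrictOut_comp_restrict hT (not_le.1 ht)) (T.restrict_comp_restrictOut hT (not_le.1 ht))]
    exact T.laurentGreen_mul_projOut hT (not_le.1 ht)

/-- The Green function solves the homogeneous equation, with a jump at zero. -/
theorem op_mul_green (T : C0Semigroup X) (hT : T.IsHyperbolic) {r : ℝ} (hr : 0 ≤ r) (q : ℝ) :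
    T.op r.toNNReal * T.green q = T.green (r + q) +
      if q < 0 ∧ 0 ≤ r + q then T.op (r + q).toNNReal else 0 := by
  simp only [T.green_eq_laurentGreen hT]
  rcases le_or_gt 0 q with hq | hq
  · rw [if_neg (by grind), T.laurentGreen_of_nonneg hT hq,
      T.laurentGreen_of_nonneg hT (add_nonneg hr hq), T.op_toNNReal_add hr hq]
    simp [mul_assoc]
  have hG := T.op_mul_laurentGreen hT hq
  rcases le_or_gt 0 (r + q) with hrq | hrq
  · rw [if_pos ⟨hq, hrq⟩, T.laurentGreen_of_nonneg hT hrq]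
    -- Here q < 0 ≤ r + q: the factor T(-q) turns G(q) into P_out, and P_out = I - P_in produces the
    -- jump.
    have h1 : T.op r.toNNReal = T.op (r + q).toNNReal * T.op (-q).toNNReal := by
      rw [← T.op_toNNReal_add hrq (by linarith)]; simp
    rw [h1, mul_assoc, hG, projOut, mul_sub, mul_one]
    abel
  · rw [if_neg (by grind), add_zero]
    -- Both times are negative: T(-(r+q)) T(r) G(q) = P_out, and multiplying by G(r+q) on the left
    -- inverts the first factor on X_out.
    have h1 : T.op (-q).toNNReal = T.op (-(r + q)).toNNReal * T.op r.toNNReal := by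
      rw [← T.op_toNNReal_add (by linarith) hr]; congr 2; ring
    rw [h1, mul_assoc] at hG
    have h2 := congrArg (T.laurentGreen (r + q) * ·) hG
    simp only [← mul_assoc, T.laurentGreen_mul_op hT hrq, T.laurentGreen_mul_projOut hT hrq] at h2
    rw [← h2, mul_assoc, (T.op_commute_laurentGreen _ q).eq, ← mul_assoc,
      T.projOut_mul_laurentGreen hT hq]

end C0Semigroup

/-! ### Convolution with the Green function and uniqueness of bounded orbits -/

/-- An ℓ¹ weight, constant on unit intervals, pairs with a uniform bound on unit integrals; this is
what makes G * y converge absolutely at every point. -/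
theorem lintegral_floor_mul_le (w : ℤ → ℝ≥0∞) (f : ℝ → ℝ≥0∞) (C : ℝ≥0∞)
    (hf : ∀ n : ℤ, ∫⁻ s in Ico (n : ℝ) (n + 1), f s ≤ C) (hfm : AEMeasurable f volume) :
    ∫⁻ s, w ⌊s⌋ * f s ≤ (∑' n, w n) * C := by
  rw [← setLIntegral_univ, ← iUnion_Ico_intCast ℝ, lintegral_iUnion (fun _ => measurableSet_Ico)
    (pairwise_disjoint_Ico_intCast ℝ), ← ENNReal.tsum_mul_right]
  refine ENNReal.tsum_le_tsum fun n => ?_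
  calc ∫⁻ s in Ico (n : ℝ) (n + 1), w ⌊s⌋ * f s
      = ∫⁻ s in Ico (n : ℝ) (n + 1), w n * f s :=
        setLIntegral_congr_fun measurableSet_Ico fun s hs => by
          simp only [Int.floor_eq_iff.2 ⟨hs.1, hs.2⟩]
    _ = w n * ∫⁻ s in Ico (n : ℝ) (n + 1), f s := lintegral_const_mul'' _ hfm.restrict
    _ ≤ w n * C := by gcongr; exact hf n

theorem lintegral_Ico_sub_left_le_stepanovENorm {X : Type*} [NormedAddCommGroup X] (y : ℝ → X)
    (t : ℝ) (n : ℤ) : ∫⁻ s in Ico (n : ℝ) (n + 1), ‖y (t - s)‖ₑ ≤ stepanovENorm y := by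
  -- Under s ↦ t - s, [n, n + 1) becomes (t - n - 1, t - n], inside the Stepanov window starting at
  -- t - (n + 1).
  refine le_trans ?_ (le_iSup _ (t - (n + 1)))
  have h := (Measure.measurePreserving_sub_left (volume : Measure ℝ) (n + 1))
    |>.setLIntegral_comp_preimage_emb
    (MeasurableEquiv.subLeft ((n : ℝ) + 1)).measurableEmbedding
    (fun s => ‖y (s + (t - (n + 1)))‖ₑ) (Icc 0 1)
  rw [← h]
  refine le_trans (le_of_eq ?_) (lintegral_mono_set (s := Ico (n : ℝ) (n + 1)) ?_)
  · congr 1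
    funext s
    congr 2
    ring
  · rintro s ⟨h1, h2⟩
    constructor <;> linarith

namespace C0Semigroup

variable {X : Type*} [NormedAddCommGroup X] [NormedSpace ℂ X] [CompleteSpace X]

theorem exists_norm_op_le (T : C0Semigroup X) (b : ℝ≥0) :
    ∃ M : ℝ≥0, ∀ t ≤ b, ‖T.op t‖ ≤ M := by
  obtain ⟨M, hM⟩ : ∃ M, ∀ i : Icc (0 : ℝ≥0) b, ‖T.op i‖ ≤ M := by
    refine banach_steinhaus fun w => ?_
    obtain ⟨c, hc⟩ := (isCompact_Icc (a := (0 : ℝ≥0)) (b := b)).exists_bound_of_continuousOn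
      (T.continuous_orbit w).continuousOn
    exact ⟨c, fun i => hc i i.2⟩
  exact ⟨M.toNNReal, fun t ht => (hM ⟨t, zero_le, ht⟩).trans (Real.le_coe_toNNReal M)⟩

/-- The coefficient depends on ⌊s⌋ only, hence is measurable in operator norm; the semigroup factor
enters through the joint continuity of (t, v) ↦ T(t) v. -/
theorem aestronglyMeasurable_green (T : C0Semigroup X) (hT : T.IsHyperbolic) {z : ℝ → X}
    (hz : AEStronglyMeasurable z volume) :
    AEStronglyMeasurable (fun s => T.green s (z s)) volume := by
  simp only [T.green_eq_laurentGreen hT, laurentGreen, neg_apply,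
    mul_apply_eq_comp]
  have h1 : StronglyMeasurable fun s : ℝ => laurentCoeff (T.op 1) ⌊s⌋ :=
    (StronglyMeasurable.of_discrete (f := laurentCoeff (T.op 1))).comp_measurable
      Int.measurable_floor
  have h2 : AEStronglyMeasurable (fun s : ℝ => laurentCoeff (T.op 1) ⌊s⌋ (z s)) volume :=
    isBoundedBilinearMap_apply.continuous.comp_aestronglyMeasurable
      (h1.aestronglyMeasurable.prodMk hz)
  have h3 : Measurable fun s : ℝ => (Int.fract s).toNNReal := measurable_fract.real_toNNReal
  exact (T.continuous_uncurry.comp_aestronglyMeasurable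
    (h3.aestronglyMeasurable.prodMk h2)).neg

theorem exists_norm_green_le (T : C0Semigroup X) (hT : T.IsHyperbolic) :
    ∃ w : ℤ → ℝ≥0, Summable w ∧ ∀ s, ‖T.green s‖ ≤ w ⌊s⌋ := by
  obtain ⟨M, hM⟩ := T.exists_norm_op_le 1
  refine ⟨fun n => M * ‖laurentCoeff (T.op 1) n‖₊, ?_, fun s => ?_⟩
  · refine NNReal.summable_coe.1 ?_
    simpa using (T.isGreenSequence hT).summable_norm.mul_left (M : ℝ)
  · rw [T.green_eq_laurentGreen hT, laurentGreen, norm_neg]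
    refine (norm_mul_le _ _).trans ?_
    push_cast
    gcongr
    exact hM _ (by simpa using (Int.fract_lt_one s).le)

theorem integrable_green_apply (T : C0Semigroup X) (hT : T.IsHyperbolic) {z : ℝ → X}
    (hz : AEStronglyMeasurable z volume) {C : ℝ≥0}
    (hC : ∀ n : ℤ, ∫⁻ s in Ico (n : ℝ) (n + 1), ‖z s‖ₑ ≤ C) :
    Integrable (fun s => T.green s (z s)) volume := by
  obtain ⟨w, hw, hle⟩ := T.exists_norm_green_le hT
  refine ⟨T.aestronglyMeasurable_green hT hz, ?_⟩
  refine lt_of_le_of_lt (lintegral_mono fun s => ?_)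
    ((lintegral_floor_mul_le (fun n => w n) (fun s => ‖z s‖ₑ) C hC hz.enorm).trans_lt
      (ENNReal.mul_lt_top (ENNReal.tsum_coe_ne_top_iff_summable.2 hw).lt_top ENNReal.coe_lt_top))
  calc ‖T.green s (z s)‖ₑ ≤ ‖T.green s‖ₑ * ‖z s‖ₑ := (T.green s).le_opENorm _
    _ ≤ w ⌊s⌋ * ‖z s‖ₑ := by
      gcongr
      exact ENNReal.coe_le_coe.2 (hle s)

theorem memL1s_green (T : C0Semigroup X) (hT : T.IsHyperbolic) : MemL1s T.green := by
  refine ⟨fun v => T.aestronglyMeasurable_green hT aestronglyMeasurable_const, ?_⟩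
  obtain ⟨w, hw, hle⟩ := T.exists_norm_green_le hT
  have hm : Measurable fun s : ℝ => (w ⌊s⌋ : ℝ) :=
    (measurable_from_top (f := fun n : ℤ => (w n : ℝ))).comp Int.measurable_floor
  refine ⟨fun s => w ⌊s⌋, ⟨hm.aestronglyMeasurable, ?_⟩, ae_of_all _ hle⟩
  refine lt_of_le_of_lt (le_of_eq ?_)
    ((lintegral_floor_mul_le (fun n => w n) (fun _ => 1) 1 (by simp) aemeasurable_const).trans_lt
      (ENNReal.mul_lt_top (ENNReal.tsum_coe_ne_top_iff_summable.2 hw).lt_top ENNReal.one_lt_top))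
  refine lintegral_congr fun s => ?_
  simp [enorm, NNReal.nnnorm_eq]

theorem integrable_green_conv (T : C0Semigroup X) (hT : T.IsHyperbolic) {y : ℝ → X}
    (hy : AEStronglyMeasurable y volume) (hs : stepanovENorm y < ∞) (t : ℝ) :
    Integrable (fun τ => T.green (t - τ) (y τ)) volume := by
  have h := T.integrable_green_apply hT (z := fun s => y (t - s)) (C := (stepanovENorm y).toNNReal)
    (hy.comp_measurePreserving (Measure.measurePreserving_sub_left volume t)) fun n => by
      rw [ENNReal.coe_toNNReal hs.ne]
      exact lintegral_Ico_sub_left_le_stepanovENorm y t n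
  simpa using h.comp_sub_left t

/-- The convolution with the Green function solves the inhomogeneous equation. -/
theorem green_conv_eq (T : C0Semigroup X) (hT : T.IsHyperbolic) {y : ℝ → X}
    (hy : LocallyIntegrable y volume) (hs : stepanovENorm y < ∞) {s t : ℝ} (hst : s ≤ t) :
    ∫ τ, T.green (t - τ) (y τ) = T.op (t - s).toNNReal (∫ τ, T.green (s - τ) (y τ)) -
      ∫ τ in s..t, T.op (t - τ).toNNReal (y τ) := by
  have hi := T.integrable_green_conv hT hy.aestronglyMeasurable hs
  have hI : IntegrableOn (fun τ => T.op (t - τ).toNNReal (y τ)) (Ioc s t) volume :=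
    (intervalIntegrable_iff_integrableOn_Ioc_of_le hst).1 (T.intervalIntegrable hy hst)
  rw [intervalIntegral.integral_of_le hst, ← integral_indicator measurableSet_Ioc,
    ← ContinuousLinearMap.integral_comp_comm _ (hi s), eq_sub_iff_add_eq,
    ← integral_add (hi t) (hI.integrable_indicator measurableSet_Ioc)]
  refine integral_congr_ae (ae_of_all _ fun τ => ?_)
  -- With r = t - s and q = s - τ, the jump condition q < 0 ≤ r + q reads τ ∈ (s, t], so the jump
  -- term is the indicator of `Ioc s t`.
  have h := DFunLike.congr_fun (T.op_mul_green hT (sub_nonneg.2 hst) (s - τ)) (y τ)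
  rw [show t - s + (s - τ) = t - τ by ring] at h
  simp only [mul_apply_eq_comp, add_apply] at h ⊢
  rw [h, indicator]
  by_cases hm : τ ∈ Ioc s t
  · rw [if_pos hm, if_pos ⟨by linarith [hm.1], by linarith [hm.2]⟩]
  · rw [if_neg hm, if_neg fun h' => hm ⟨by linarith [h'.1], by linarith [h'.2]⟩]
    simp

/-- A Stepanov bounded orbit, defined on all of `ℝ`, of a hyperbolic semigroup vanishes. -/
theorem eq_zero_of_orbit (T : C0Semigroup X) (hT : T.IsHyperbolic) {u : ℝ → X}
    (hs : stepanovENorm u < ∞)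
    (hu : ∀ s t, s ≤ t → u t = T.op (t - s).toNNReal (u s)) (t : ℝ) : u t = 0 := by
  obtain ⟨M, hM⟩ := T.exists_norm_op_le 1
  have hb : ∀ t, ‖u t‖ₑ ≤ M * stepanovENorm u := fun t => by
    -- Averaging ‖u(t)‖ ≤ M ‖u(σ)‖ over σ ∈ [t - 1, t] upgrades the Stepanov bound to a uniform one.
    have h1 : ∫⁻ s in Icc (0 : ℝ) 1, ‖u t‖ₑ ≤ ∫⁻ s in Icc (0 : ℝ) 1, M * ‖u (s + (t - 1))‖ₑ := by
      refine setLIntegral_mono' measurableSet_Icc fun s hs => ?_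
      rw [hu (s + (t - 1)) t (by linarith [hs.2])]
      refine ((T.op _).le_opENorm _).trans ?_
      gcongr
      exact ENNReal.coe_le_coe.2 (hM _ (Real.toNNReal_le_one.2 (by linarith [hs.1])))
    rw [lintegral_const, lintegral_const_mul' _ _ ENNReal.coe_ne_top] at h1
    refine le_trans (by simp) (h1.trans ?_)
    gcongr
    exact le_iSup (fun t : ℝ => ∫⁻ s in Icc (0 : ℝ) 1, ‖u (s + t)‖ₑ) (t - 1)
  obtain ⟨N, hN⟩ : ∃ N : ℝ≥0, ∀ t, ‖u t‖ ≤ N := by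
    refine ⟨(M * stepanovENorm u).toNNReal, fun t => ?_⟩
    have := hb t
    rw [← ENNReal.coe_toNNReal (ENNReal.mul_lt_top ENNReal.coe_lt_top hs).ne] at this
    exact ENNReal.coe_le_coe.1 this
  have hc := T.isGreenSequence hT
  have hz : ∀ (c : ℕ → X →L[ℂ] X) (v : ℕ → X) (x : X), Tendsto c atTop (𝓝 0) →
      (∀ n, ‖v n‖ ≤ N) → (∀ n, x = c n (v n)) → x = 0 := by
    intro c v x h1 h2 h3
    have h4 : Tendsto (fun n => ‖c n‖ * N) atTop (𝓝 0) := by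
      simpa using h1.norm.mul_const (N : ℝ)
    refine norm_le_zero_iff.1 (ge_of_tendsto' h4 fun n => ?_)
    rw [h3 n]
    exact (c n).le_opNorm_of_le (h2 n)
  -- From the past: c_0 u(t) = c_0 aⁿ u(t - n) = c_n u(t - n).
  have hin : laurentCoeff (T.op 1) 0 (u t) = 0 := by
    refine hz _ (fun n => u (t - n)) _ hc.tendsto_nat (fun n => hN _) fun n => ?_
    rw [hu (t - n) t (by simp), sub_sub_cancel, Real.toNNReal_natCast, T.op_natCast, hc.nat_eq,
      ((hc.commute 0).pow_left n).eq]
    rfl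
  -- From the future: (1 - c_0) u(t) = -c_{-n-1} a^{n+1} u(t) = -c_{-n-1} u(t + n + 1).
  have hout : u t - laurentCoeff (T.op 1) 0 (u t) = 0 := by
    refine hz _ (fun n => u (t + (n + 1 : ℕ))) _ (by simpa using hc.tendsto_negSucc.neg)
      (fun n => hN _) fun n => ?_
    rw [hu t (t + (n + 1 : ℕ)) (by simp only [le_add_iff_nonneg_right]; positivity),
      add_sub_cancel_left, Real.toNNReal_natCast, T.op_natCast]
    have h := DFunLike.congr_fun (hc.pow_mul_negSucc n) (u t)
    rw [((hc.commute _).pow_left _).eq] at h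
    simp only [mul_apply_eq_comp, sub_apply,
      one_apply_eq_self] at h
    rw [neg_apply, h, neg_sub]
  rwa [hin, sub_zero] at hout

end C0Semigroup

/-! ### Single-valuedness of -d/dt + A -/

namespace C0Semigroup

variable {X : Type*} [NormedAddCommGroup X] [NormedSpace ℂ X] [CompleteSpace X]

theorem ae_op_apply_eq_zero (T : C0Semigroup X) {y : ℝ → X} (hy : LocallyIntegrable y volume)
    {t : ℝ} (h : ∀ᵐ s, s ≤ t → ∫ τ in s..t, T.op (t - τ).toNNReal (y τ) = 0) :
    ∀ᵐ s, s < t → T.op (t - s).toNNReal (y s) = 0 := by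
  have hn : ∀ n : ℕ, ∀ᵐ s, s ∈ Ioo (t - n) t → T.op (t - s).toNNReal (y s) = 0 := fun n => by
    have hle : t - n ≤ t := by simp
    have hi := T.intervalIntegrable hy hle
    have hc := intervalIntegral.continuousOn_primitive_interval' hi right_mem_uIcc
    rw [uIcc_of_le hle] at hc
    -- The primitive is continuous, so vanishing almost everywhere on an open interval it vanishes
    -- throughout, and so does its derivative.
    have hz : EqOn (fun s => ∫ τ in t..s, T.op (t - τ).toNNReal (y τ)) (fun _ => 0)
        (Ioo (t - n) t) := by
      refine Measure.eqOn_open_of_ae_eq (μ := volume) ?_ isOpen_Ioo (hc.mono Ioo_subset_Icc_self)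
        continuousOn_const
      filter_upwards [ae_restrict_of_ae h, ae_restrict_mem measurableSet_Ioo] with s hs hm
      rw [intervalIntegral.integral_symm, hs hm.2.le, neg_zero]
    filter_upwards [hi.ae_hasDerivAt_integral] with s hs hm
    have hd := hs (by rw [uIcc_of_le hle]; exact Ioo_subset_Icc_self hm) t right_mem_uIcc
    refine hd.unique ((hasDerivAt_const s (0 : X)).congr_of_eventuallyEq ?_)
    filter_upwards [isOpen_Ioo.mem_nhds hm] with x hx using hz hx
  filter_upwards [ae_all_iff.2 hn] with s hs hst
  obtain ⟨n, hn⟩ := exists_nat_gt (t - s)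
  exact hs n ⟨by linarith, hst⟩

/-- The defining relation of `-d/dt + A` is single-valued. -/
theorem ae_eq_zero_of_solution (T : C0Semigroup X) {y u : ℝ → X}
    (hy : LocallyIntegrable y volume) (hu : u =ᵐ[volume] 0)
    (h : ∀ s t : ℝ, s ≤ t →
      u t = T.op (t - s).toNNReal (u s) - ∫ τ in s..t, T.op (t - τ).toNNReal (y τ)) :
    y =ᵐ[volume] 0 := by
  have h1 : ∀ t, u t = 0 → ∀ᵐ s, s < t → T.op (t - s).toNNReal (y s) = 0 := fun t ht => by
    refine T.ae_op_apply_eq_zero hy ?_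
    filter_upwards [hu] with s hs hst
    have := h s t hst
    rwa [ht, hs, Pi.zero_apply, map_zero, zero_sub, zero_eq_neg] at this
  -- The exceptional null set of s depends on t; a countable dense set of t allows one null set for
  -- all, and strong continuity as t ↓ s recovers y(s) = 0.
  obtain ⟨Q, hQ, hQc, hQd⟩ :=
    Dense.exists_countable_dense_subset (s := {t | u t = 0}) (Measure.dense_of_ae hu)
  filter_upwards [(ae_ball_iff hQc).2 fun t ht => h1 t (hQ ht)] with s hs
  have hcl : IsClosed {t : ℝ | T.op (t - s).toNNReal (y s) = 0} :=
    isClosed_singleton.preimage ((T.continuous_orbit (y s)).comp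
      (continuous_real_toNNReal.comp (continuous_sub_right s)))
  have hsub : closure (Ioi s) ⊆ {t : ℝ | T.op (t - s).toNNReal (y s) = 0} :=
    (closure_minimal (hQd.open_subset_closure_inter isOpen_Ioi) isClosed_closure).trans
      (closure_minimal (fun t ht => hs t ht.2 ht.1) hcl)
  have h0 := hsub (by rw [closure_Ioi]; exact self_mem_Ici)
  simpa [T.op_zero] using h0

end C0Semigroup

/-! ### Green convolution as a bounded operator on F -/

namespace HomogeneousFunctionSpace

variable {X F : Type*} [NormedAddCommGroup X] [NormedSpace ℂ X]
  [NormedAddCommGroup F] [NormedSpace ℂ F] [CompleteSpace F]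

theorem stepanovENorm_lt_top (H : HomogeneousFunctionSpace X F) (x : F) :
    stepanovENorm (H.embed x) < ∞ := by
  obtain ⟨c, hc⟩ := H.stepanov_le
  exact (hc x).trans_lt (ENNReal.mul_lt_top ENNReal.coe_lt_top enorm_lt_top)

theorem eq_of_embed_ae_eq (H : HomogeneousFunctionSpace X F) {x y : F}
    (h : H.embed x =ᵐ[volume] H.embed y) : x = y :=
  H.embed_injective (AEEqFun.ext h)

theorem eq_zero_of_embed_ae_eq (H : HomogeneousFunctionSpace X F) {x : F}
    (h : H.embed x =ᵐ[volume] 0) : x = 0 :=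
  H.eq_of_embed_ae_eq (by rw [map_zero]; exact h.trans AEEqFun.coeFn_zero.symm)

variable [CompleteSpace X]

theorem integrable_green_conv (H : HomogeneousFunctionSpace X F) (T : C0Semigroup X)
    (hT : T.IsHyperbolic) (y : F) (t : ℝ) :
    Integrable (fun τ => T.green (t - τ) (H.embed y τ)) volume :=
  T.integrable_green_conv hT (H.locallyIntegrable y).aestronglyMeasurable
    (H.stepanovENorm_lt_top y) t

/-- Convolution with the Green function, as a bounded operator. -/
theorem exists_green_operator (H : HomogeneousFunctionSpace X F) (T : C0Semigroup X)
    (hT : T.IsHyperbolic) : ∃ K : F →L[ℂ] F, ∀ y : F,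
      H.embed (K y) =ᵐ[volume] fun t => ∫ τ, T.green (t - τ) (H.embed y τ) := by
  have hconv : ∀ y : F, ∃ x : F,
      (H.embed x =ᵐ[volume] fun t => ∫ τ, T.green (t - τ) (H.embed y τ)) ∧
        ‖x‖ ≤ normL1s T.green * ‖y‖ := fun y => by
    obtain ⟨x, hx, hn⟩ := H.conv T.green (T.memL1s_green hT) y
    refine ⟨x, hx.trans (ae_of_all _ fun t => ?_), hn⟩
    simpa using integral_sub_left_eq_self
      (fun τ => T.green (t - τ) (H.embed y τ)) volume t
  choose k hk hkn using hconv
  -- Injectivity of the embedding reduces linearity of the chosen k to linearity of the integral.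
  refine ⟨LinearMap.mkContinuous ⟨⟨k, fun y z => ?_⟩, fun c y => ?_⟩ _ hkn, hk⟩
  · refine H.eq_of_embed_ae_eq ?_
    have h1 : (H.embed (y + z) : ℝ → X) =ᵐ[volume] H.embed y + H.embed z := by
      rw [map_add]; exact AEEqFun.coeFn_add _ _
    have h2 : (H.embed (k y + k z) : ℝ → X) =ᵐ[volume] H.embed (k y) + H.embed (k z) := by
      rw [map_add]; exact AEEqFun.coeFn_add _ _
    filter_upwards [hk (y + z), hk y, hk z, h2] with t ht hty htz ht2
    rw [ht, ht2, Pi.add_apply, hty, htz, ← integral_add (H.integrable_green_conv T hT y t)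
      (H.integrable_green_conv T hT z t)]
    refine integral_congr_ae ?_
    filter_upwards [h1] with τ hτ
    rw [hτ, Pi.add_apply, map_add]
  · refine H.eq_of_embed_ae_eq ?_
    have h1 : (H.embed (c • y) : ℝ → X) =ᵐ[volume] c • (H.embed y : ℝ → X) := by
      rw [map_smul]; exact AEEqFun.coeFn_smul _ _
    have h2 : (H.embed (c • k y) : ℝ → X) =ᵐ[volume] c • (H.embed (k y) : ℝ → X) := by
      rw [map_smul]; exact AEEqFun.coeFn_smul _ _
    filter_upwards [hk (c • y), hk y, h2] with t ht hty ht2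
    simp only [RingHom.id_apply]
    rw [ht, ht2, Pi.smul_apply, hty, ← integral_smul]
    refine integral_congr_ae ?_
    filter_upwards [h1] with τ hτ
    rw [hτ, Pi.smul_apply, map_smul]

end HomogeneousFunctionSpace

/-! ### The graph of -d/dt + A and its inverse -/

section ParabolicGraph

variable {X F : Type*} [NormedAddCommGroup X] [NormedSpace ℂ X] [CompleteSpace X]
  [NormedAddCommGroup F] [NormedSpace ℂ F] [CompleteSpace F]

theorem parabolicOperator_graph (H : HomogeneousFunctionSpace X F) (T : C0Semigroup X) :
    (parabolicOperator T H).graph = parabolicGraph T H := by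
  refine Submodule.toLinearPMap_graph_eq _ ?_
  rintro ⟨x, y⟩ ⟨u, hu, h⟩ (rfl : x = 0)
  refine H.eq_zero_of_embed_ae_eq
    (T.ae_eq_zero_of_solution (H.locallyIntegrable y) (hu.trans ?_) h)
  rw [map_zero]
  exact AEEqFun.coeFn_zero

theorem eq_zero_of_mem_parabolicGraph (H : HomogeneousFunctionSpace X F) (T : C0Semigroup X)
    (hT : T.IsHyperbolic) {x : F} (hx : (x, (0 : F)) ∈ parabolicGraph T H) : x = 0 := by
  obtain ⟨u, hu, h⟩ := hx
  have h0 : (H.embed (0 : F) : ℝ → X) =ᵐ[volume] 0 := by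
    rw [map_zero]; exact AEEqFun.coeFn_zero
  have hs : stepanovENorm u < ∞ := by
    -- The Stepanov norm does not see the choice of representative, because translations preserve
    -- null sets.
    convert H.stepanovENorm_lt_top x using 1
    refine iSup_congr fun t => lintegral_congr_ae (ae_restrict_of_ae ?_)
    filter_upwards [(measurePreserving_add_right (volume : Measure ℝ) t).quasiMeasurePreserving.ae
      hu] with s hs
    exact congrArg _ hs
  refine H.eq_zero_of_embed_ae_eq (hu.symm.trans (ae_of_all _ fun t =>
    T.eq_zero_of_orbit hT hs (fun s t hst => ?_) t))
  rw [h s t hst, intervalIntegral.integral_congr_ae (g := fun _ => (0 : X))]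
  · simp
  · filter_upwards [h0] with τ hτ _
    rw [hτ, Pi.zero_apply, map_zero]

/-- The representative required by the graph is the convolution integral itself, which satisfies the
equation at every pair s ≤ t. -/
theorem mem_parabolicGraph_of_green_conv (H : HomogeneousFunctionSpace X F) (T : C0Semigroup X)
    (hT : T.IsHyperbolic) {x y : F}
    (hx : H.embed x =ᵐ[volume] fun t => ∫ τ, T.green (t - τ) (H.embed y τ)) :
    (x, y) ∈ parabolicGraph T H :=
  ⟨_, hx.symm, fun _ _ hst =>
    T.green_conv_eq hT (H.locallyIntegrable y) (H.stepanovENorm_lt_top y) hst⟩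

end ParabolicGraph

theorem theorem3p1 {X F : Type*}
    [NormedAddCommGroup X] [NormedSpace ℂ X] [CompleteSpace X]
    [NormedAddCommGroup F] [NormedSpace ℂ F] [CompleteSpace F]
    (H : HomogeneousFunctionSpace X F) (T : C0Semigroup X) (hT : T.IsHyperbolic) :
    -- the operator is well defined: the defining relation is single-valued and is its graph
    (parabolicOperator T H).graph = parabolicGraph T H ∧
    -- it is injective and surjective
    (∀ x : (parabolicOperator T H).domain, parabolicOperator T H x = 0 → x = 0) ∧
    (∀ y : F, ∃ x : (parabolicOperator T H).domain, parabolicOperator T H x = y) ∧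
    -- the inverses in the definition of the Green function exist, and it belongs to `L¹_s`
    (∀ t : ℝ≥0, (T.restrictOut t).IsInvertible) ∧
    MemL1s T.green ∧
    -- the inverse is bounded, and is the convolution with the Green function
    ∃ K : F →L[ℂ] F,
      (∀ x : (parabolicOperator T H).domain, K (parabolicOperator T H x) = x) ∧
      (∀ y : F, ∃ h : K y ∈ (parabolicOperator T H).domain,
        parabolicOperator T H ⟨K y, h⟩ = y) ∧
      ∀ y : F,
        (∀ t : ℝ, Integrable (fun τ => T.green (t - τ) (H.embed y τ)) volume) ∧
        ∀ᵐ t : ℝ, H.embed (K y) t = ∫ τ, T.green (t - τ) (H.embed y τ) := by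
  have hg := parabolicOperator_graph H T
  obtain ⟨K, hK⟩ := H.exists_green_operator T hT
  have hinj : ∀ x : (parabolicOperator T H).domain, parabolicOperator T H x = 0 → x = 0 := by
    intro x hx
    refine Subtype.ext (eq_zero_of_mem_parabolicGraph H T hT ?_)
    rw [← hg, ← hx]
    exact (parabolicOperator T H).mem_graph x
  have hinv : ∀ y : F, ∃ h : K y ∈ (parabolicOperator T H).domain,
      parabolicOperator T H ⟨K y, h⟩ = y := fun y => by
    have hy := mem_parabolicGraph_of_green_conv H T hT (hK y)
    rw [← hg, LinearPMap.mem_graph_iff] at hy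
    obtain ⟨z, hz1, hz2⟩ := hy
    have hd : K y ∈ (parabolicOperator T H).domain := Set.mem_of_eq_of_mem hz1.symm z.2
    exact ⟨hd, (congrArg _ (Subtype.ext hz1.symm)).trans hz2⟩
  refine ⟨hg, hinj, fun y => ?_, T.restrictOut_isInvertible hT, T.memL1s_green hT, K, fun x => ?_,
    hinv, fun y => ⟨H.integrable_green_conv T hT y, hK y⟩⟩
  · obtain ⟨h, hy⟩ := hinv y
    exact ⟨⟨K y, h⟩, hy⟩
  -- A right inverse of an injective operator is also a left inverse.
  · obtain ⟨h, hy⟩ := hinv (parabolicOperator T H x)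
    have h0 := hinj (⟨_, h⟩ - x) (by rw [LinearPMap.map_sub, hy, sub_self])
    exact congrArg Subtype.val (sub_eq_zero.1 h0)
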